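/- Let $\mathcal H$ be a real Hilbert space and let $g:\mathcal H\to\mathbb R$ be convex and Fréchet differentiable, with $\nabla g$ Lipschitz continuous on bounded sets and $\operatorname{argmin} g\neq\emptyset$. Let $t_0>0$, $\alpha>0$, $q\in(0,1)$, and let either $\gamma>0$ and $\beta\in\mathbb R$, or $\gamma=0$ and $\beta>0$; if $\beta<0$, assume moreover that $t_0>\left|\frac{\beta}{\gamma}\right|^{1/q}$. Let $\varepsilon:[t_0,+\infty)\to[0,+\infty)$ be non-increasing and of class $C^1$ with $\lim_{t\to+\infty}\varepsilon(t)=0$. Assume that there is $K>0$ such that $$\frac{q(1-q)}{t^2}\le\varepsilon(t)\le\frac{K}{t^q}\quad\text{for all sufficiently large } t,$$ and that $\int_{t_0}^{+\infty}t^q\varepsilon(t)\,dt<+\infty$. Let $u_0,v_0\in\mathcal H$ and let $x:[t_0,+\infty)\to\mathcal H$ be a global classical solution (of class $C^1$ on $[t_0,+\infty)$ and $C^2$ on $(t_0,+\infty)$) of $$\ddot x(t)+\frac{\alpha}{t^q}\dot x(t)+\nabla g\!\left(x(t)+\Big(\gamma+\frac{\beta}{t^q}\Big)\dot x(t)\right)+\varepsilon(t)x(t)=0\quad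 (t>t_0),\qquad x(t_0)=u_0,\ \dot x(t_0)=v_0.$$ Then $x(t)$ converges weakly in $\mathcal H$, as $t\to+\infty$, to an element of $\operatorname{argmin} g$. -/

import Mathlib

open Set Filter Topology

/-- The set of global minimizers of `g`. -/
def argmin {H : Type*} (g : H → ℝ) : Set H := {z | ∀ y, g z ≤ g y}

/-- `F` is Lipschitz continuous on every bounded set (the constant may depend on the set). -/
def LipschitzOnBounded {H : Type*} [NormedAddCommGroup H] (F : H → H) : Prop :=
  ∀ s : Set H, Bornology.IsBounded s → ∃ L : NNReal, LipschitzOnWith L F s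

/-- `x` is a global classical solution on `[t₀, ∞)` of the Cauchy problem
`x'' + (α / t^q) x' + ∇g (x + (γ + β / t^q) x') + ε(t) x = 0`, `x(t₀) = u₀`, `x'(t₀) = v₀`.
Only the values of `x` on `[t₀, ∞)` matter; the derivative at `t₀` is the right derivative. -/
structure IsGlobalSolution {H : Type*} [NormedAddCommGroup H] [InnerProductSpace ℝ H]
    [CompleteSpace H] (g : H → ℝ) (ε : ℝ → ℝ) (α β γ q t₀ : ℝ) (u₀ v₀ : H) (x : ℝ → H) :
    Prop where
  contDiffOn_Ici : ContDiffOn ℝ 1 x (Ici t₀)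
  contDiffOn_Ioi : ContDiffOn ℝ 2 x (Ioi t₀)
  position_init : x t₀ = u₀
  velocity_init : HasDerivWithinAt x v₀ (Ici t₀) t₀
  equation : ∀ t, t₀ < t →
    deriv (deriv x) t + (α / t ^ q) • deriv x t
      + gradient g (x t + (γ + β / t ^ q) • deriv x t) + ε t • x t = 0

/-! Write s = t^q, r = s', v = x', θ = γ + β/s, y = x + θv, and fix a minimizer z. For each b in (0,
α) the energy E_b, a sum of s²(g(y) − g(z)), ‖b(x − z) + sv‖²/2, a multiple of ‖x − z‖² and a
Tikhonov term, satisfies E_b' ≤ C sε(1 + E_b) for large t. Since sε is integrable, E_b converges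
(`exists_tendsto_lyapunovEnergy`).

Boundedness of E_b keeps x and sv bounded and gives g(y) → min g with v → 0, so weak cluster points
of x are minimizers. As b is free, subtracting two energies cancels all but a multiple of sh' + (α −
r)h with h = ‖x − z‖². Hence sh' + αh converges, so does h
(`tendsto_of_tendsto_rpow_mul_deriv_add_mul`), and Opial's lemma concludes. -/

section ConvexGradient

variable {H : Type*} [NormedAddCommGroup H] [InnerProductSpace ℝ H] [CompleteSpace H]

theorem ConvexOn.add_inner_gradient_le {g : H → ℝ} (hg : ConvexOn ℝ univ g)
    {a : H} (hd : DifferentiableAt ℝ g a) (w : H) :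
    g a + inner ℝ (gradient g a) (w - a) ≤ g w := by
  have hline : HasDerivAt (fun τ : ℝ => a + τ • (w - a)) (w - a) 0 := by
    simpa using ((hasDerivAt_id (0 : ℝ)).smul_const (w - a)).const_add a
  have hgr : HasFDerivAt g (InnerProductSpace.toDual ℝ H (gradient g a)) (a + (0 : ℝ) • (w - a)) := by
    simpa using hd.hasGradientAt.hasFDerivAt
  have hder := hgr.comp_hasDerivAt (0 : ℝ) hline
  have hconv : ConvexOn ℝ univ (g ∘ fun τ : ℝ => a + τ • (w - a)) := by
    have hfun : (fun τ : ℝ => a + τ • (w - a)) = (AffineMap.lineMap a w : ℝ →ᵃ[ℝ] H) := by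
      funext τ
      simp [AffineMap.lineMap_apply, add_comm]
    rw [hfun]
    exact hg.comp_affineMap (AffineMap.lineMap a w : ℝ →ᵃ[ℝ] H)
  have h := hconv.le_slope_of_hasDerivAt (mem_univ 0) (mem_univ 1) one_pos hder
  rw [InnerProductSpace.toDual_apply_apply] at h
  simp only [slope_def_field, Function.comp_apply, zero_smul, one_smul, add_zero,
    add_sub_cancel, sub_zero, div_one] at h
  linarith

end ConvexGradient

/-! ### Asymptotics of scalar differential inequalities. -/

/-- Grönwall: with M a primitive of m, exp(−M)(1 + E) is nonincreasing and nonnegative, and M itself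
converges. -/
theorem tendsto_of_deriv_le_mul_one_add {E E' m : ℝ → ℝ} {T : ℝ}
    (hE : ∀ t, T ≤ t → HasDerivAt E (E' t) t) (hE0 : ∀ t, T ≤ t → 0 ≤ E t)
    (hm : ContinuousOn m (Ici T)) (hmi : MeasureTheory.IntegrableOn m (Ioi T))
    (hle : ∀ t, T ≤ t → E' t ≤ m t * (1 + E t)) :
    ∃ l, Tendsto E atTop (𝓝 l) := by
  set M : ℝ → ℝ := fun t => ∫ u in T..t, m u with hM
  have hMlim : Tendsto M atTop (𝓝 (∫ u in Ioi T, m u)) :=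
    MeasureTheory.intervalIntegral_tendsto_integral_Ioi T hmi tendsto_id
  have hMc : ContinuousOn M (Ici T) := by
    intro t ht
    have : ContinuousOn M (Icc T (t + 1)) := by
      have := intervalIntegral.continuousOn_primitive_interval (μ := MeasureTheory.volume)
        (a := T) (b := t + 1) (f := m) ?_
      · rwa [uIcc_of_le (by linarith [mem_Ici.1 ht])] at this
      · rw [uIcc_of_le (by linarith [mem_Ici.1 ht])]
        exact (hm.mono Icc_subset_Ici_self).integrableOn_Icc
    refine (this t ⟨ht, by linarith⟩).mono_of_mem_nhdsWithin ?_
    filter_upwards [self_mem_nhdsWithin, mem_nhdsWithin_of_mem_nhds (Iio_mem_nhds (lt_add_one t))]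
      with u h1 h2 using ⟨h1, le_of_lt h2⟩
  have hMd : ∀ t, T < t → HasDerivAt M (m t) t := by
    intro t ht
    have hIcc : MeasureTheory.IntegrableOn m (Icc T t) :=
      (hm.mono Icc_subset_Ici_self).integrableOn_Icc
    refine intervalIntegral.integral_hasDerivAt_right ?_ ?_ ?_
    · exact (intervalIntegrable_iff_integrableOn_Icc_of_le ht.le).2 hIcc
    · exact (hm.mono Ioi_subset_Ici_self).stronglyMeasurableAtFilter isOpen_Ioi t ht
    · exact hm.continuousAt (Ici_mem_nhds ht)
  set F : ℝ → ℝ := fun t => Real.exp (-M t) * (1 + E t) with hF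
  have hFanti : AntitoneOn F (Ici T) := by
    have hd : ∀ t, T < t → HasDerivAt F
        (Real.exp (-M t) * (-m t) * (1 + E t) + Real.exp (-M t) * (E' t)) t := by
      intro t ht
      exact ((hMd t ht).neg.exp).mul ((hE t ht.le).const_add 1)
    refine antitoneOn_of_deriv_nonpos (convex_Ici T) ?_ ?_ ?_
    · refine (hMc.neg.rexp).mul (continuousOn_const.add ?_)
      exact fun t ht => (hE t ht).continuousAt.continuousWithinAt
    · intro t ht
      rw [interior_Ici] at ht
      exact (hd t ht).differentiableAt.differentiableWithinAt
    · intro t ht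
      rw [interior_Ici] at ht
      rw [(hd t ht).deriv]
      have := mul_le_mul_of_nonneg_left (hle t (le_of_lt ht)) (Real.exp_pos (-M t)).le
      linarith
  have hFpos : ∀ t, T ≤ t → 0 ≤ F t := fun t ht =>
    mul_nonneg (Real.exp_pos _).le (by linarith [hE0 t ht])
  have hFlim : ∃ l, Tendsto F atTop (𝓝 l) := by
    set F₁ : ℝ → ℝ := fun t => F (max T t) with hF₁
    have ha : Antitone F₁ := fun u w huw =>
      hFanti (le_max_left T u) (le_max_left T w) (max_le_max le_rfl huw)
    have hb : BddBelow (range F₁) := ⟨0, by rintro _ ⟨t, rfl⟩; exact hFpos _ (le_max_left T t)⟩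
    refine ⟨_, (tendsto_atTop_ciInf ha hb).congr' ?_⟩
    filter_upwards [eventually_ge_atTop T] with t ht
    simp [hF₁, max_eq_right ht]
  obtain ⟨l, hl⟩ := hFlim
  refine ⟨Real.exp (∫ u in Ioi T, m u) * l - 1, ?_⟩
  have := ((hMlim.rexp).mul hl).sub_const 1
  refine this.congr fun t => ?_
  rw [hF]
  simp only
  rw [← mul_assoc, ← Real.exp_add]
  simp

/-- The integrating factor exp(A) with A' = α/t^q diverges because q < 1, so initial data are
forgotten. The one-sided bound `upper` is applied to h and to −h. -/
theorem tendsto_of_tendsto_rpow_mul_deriv_add_mul {q α l : ℝ} (hq : q < 1) (hα : 0 < α)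
    {h h' : ℝ → ℝ} (hd : ∀ᶠ t in atTop, HasDerivAt h (h' t) t)
    (hl : Tendsto (fun t => t ^ q * h' t + α * h t) atTop (𝓝 l)) :
    Tendsto h atTop (𝓝 (l / α)) := by
  set A : ℝ → ℝ := fun t => α / (1 - q) * t ^ (1 - q) with hA
  have hAt : Tendsto A atTop atTop :=
    (tendsto_rpow_atTop (by linarith)).const_mul_atTop (div_pos hα (by linarith))
  have hAd : ∀ t : ℝ, 0 < t → HasDerivAt A (α / t ^ q) t := by
    intro t ht
    have := (Real.hasDerivAt_rpow_const (p := 1 - q) (Or.inl ht.ne')).const_mul (α / (1 - q))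
    refine this.congr_deriv ?_
    have h1 : (1 - q) ≠ 0 := by linarith
    rw [show (1 - q - 1) = -q by ring, Real.rpow_neg ht.le]
    field_simp
  have upper : ∀ (f f' : ℝ → ℝ), (∀ᶠ t in atTop, HasDerivAt f (f' t) t) → ∀ c : ℝ,
      (∀ᶠ t : ℝ in atTop, t ^ q * f' t + α * f t ≤ α * c) →
      ∀ δ > 0, ∀ᶠ t in atTop, f t < c + δ := by
    intro f f' hf c hc δ hδ
    obtain ⟨T, hT⟩ := eventually_atTop.1 ((hf.and hc).and (eventually_gt_atTop 0))
    set F : ℝ → ℝ := fun t => Real.exp (A t) * (f t - c) with hF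
    have hFd : ∀ t, T ≤ t → HasDerivAt F
        (Real.exp (A t) * (α / t ^ q) * (f t - c) + Real.exp (A t) * f' t) t := fun t ht =>
      ((hAd t (hT t ht).2).exp).mul ((hT t ht).1.1.sub_const c)
    have hFanti : AntitoneOn F (Ici T) := by
      refine antitoneOn_of_deriv_nonpos (convex_Ici T)
        (fun t ht => (hFd t ht).continuousAt.continuousWithinAt) ?_ ?_
      · intro t ht
        rw [interior_Ici] at ht
        exact (hFd t (le_of_lt ht)).differentiableAt.differentiableWithinAt
      · intro t ht
        rw [interior_Ici] at ht
        rw [(hFd t (le_of_lt ht)).deriv]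
        obtain ⟨⟨-, h2⟩, h3⟩ := hT t (le_of_lt ht)
        have hs := Real.rpow_pos_of_pos h3 q
        have : Real.exp (A t) * (α / t ^ q) * (f t - c) + Real.exp (A t) * f' t
            = Real.exp (A t) / t ^ q * (t ^ q * f' t + α * f t - α * c) := by
          field_simp
          ring
        rw [this]
        exact mul_nonpos_of_nonneg_of_nonpos (by positivity) (by linarith)
    have hsmall : Tendsto (fun t => Real.exp (-A t) * F T) atTop (𝓝 0) := by
      simpa using (Real.tendsto_exp_neg_atTop_nhds_zero.comp hAt).mul_const (F T)
    filter_upwards [hsmall.eventually (gt_mem_nhds hδ), eventually_ge_atTop T] with t h1 h2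
    have h3 := hFanti (mem_Ici.2 le_rfl) h2 h2
    have h4 := mul_le_mul_of_nonneg_left h3 (Real.exp_pos (-A t)).le
    have h5 : Real.exp (-A t) * F t = f t - c := by
      rw [hF]
      simp only
      rw [← mul_assoc, ← Real.exp_add]
      simp
    linarith
  have hl₂ : ∀ δ > 0, ∀ᶠ t in atTop, |t ^ q * h' t + α * h t - l| < α * δ := fun δ hδ => by
    simpa [Real.dist_eq] using Metric.tendsto_nhds.1 hl (α * δ) (by positivity)
  have hcan : α * (l / α) = l := by field_simp
  rw [Metric.tendsto_nhds]
  intro δ hδ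
  have hup := upper h h' hd (l / α + δ / 2) (by
    filter_upwards [hl₂ (δ / 2) (by linarith)] with t ht
    have := (abs_lt.1 ht).2
    rw [mul_add, hcan]
    linarith) (δ / 2) (by linarith)
  have hlow := upper (fun t => -h t) (fun t => -h' t) (hd.mono fun t ht => ht.neg)
    (-(l / α) + δ / 2) (by
    filter_upwards [hl₂ (δ / 2) (by linarith)] with t ht
    have := (abs_lt.1 ht).1
    linear_combination this.le + hcan) (δ / 2) (by linarith)
  filter_upwards [hup, hlow] with t h1 h2
  rw [Real.dist_eq, abs_lt]
  constructor <;> linarith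

/-! ### Weak compactness and Opial's lemma. -/

section WeakConvergence

variable {H : Type*} [NormedAddCommGroup H] [InnerProductSpace ℝ H]

theorem tendsto_toWeakSpace_iff_inner [CompleteSpace H] {ι : Type*} {l : Filter ι} {f : ι → H}
    {z : H} :
    Tendsto (fun i => toWeakSpace ℝ H (f i)) l (𝓝 (toWeakSpace ℝ H z)) ↔
      ∀ w : H, Tendsto (fun i => inner ℝ w (f i)) l (𝓝 (inner ℝ w z)) := by
  constructor
  · intro h w
    exact ((WeakBilin.eval_continuous (topDualPairing ℝ H).flip
      (InnerProductSpace.toDual ℝ H w)).tendsto _).comp h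
  · intro h
    refine (WeakBilin.isEmbedding (B := (topDualPairing ℝ H).flip) ?_).tendsto_nhds_iff.2 ?_
    · exact (separatingDual_iff_injective).1 inferInstance
    refine tendsto_pi_nhds.2 fun φ => ?_
    have := h ((InnerProductSpace.toDual ℝ H).symm φ)
    simp only [InnerProductSpace.toDual_symm_apply] at this
    exact this

/-- Banach–Alaoglu, transported by the Riesz isometry. -/
theorem isCompact_toWeakSpace_image_closedBall [CompleteSpace H] (R : ℝ) :
    IsCompact (toWeakSpace ℝ H '' Metric.closedBall 0 R) := by
  set ψ : WeakDual ℝ H → WeakSpace ℝ H := fun φ =>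
    toWeakSpace ℝ H ((InnerProductSpace.toDual ℝ H).symm (WeakDual.toStrongDual φ)) with hψ
  have hc : Continuous ψ := by
    rw [continuous_iff_continuousAt]
    intro φ
    refine tendsto_toWeakSpace_iff_inner.2 fun w => ?_
    have : ∀ φ : WeakDual ℝ H,
        inner ℝ w ((InnerProductSpace.toDual ℝ H).symm (WeakDual.toStrongDual φ)) = φ w := by
      intro φ
      rw [real_inner_comm, InnerProductSpace.toDual_symm_apply]
      rfl
    simp only [this]
    exact (WeakDual.eval_continuous w).tendsto φ
  have himage : ψ '' (WeakDual.toStrongDual ⁻¹' Metric.closedBall (0 : StrongDual ℝ H) R) =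
      toWeakSpace ℝ H '' Metric.closedBall 0 R := by
    ext y
    constructor
    · rintro ⟨φ, hφ, rfl⟩
      refine mem_image_of_mem _ ?_
      simpa using hφ
    · rintro ⟨y, hy, rfl⟩
      refine ⟨StrongDual.toWeakDual (InnerProductSpace.toDual ℝ H y), ?_, ?_⟩
      · simpa using hy
      · simp [hψ]
  rw [← himage]
  exact (WeakDual.isCompact_closedBall (𝕜 := ℝ) (0 : StrongDual ℝ H) R).image hc

/-- Opial's lemma. -/
theorem exists_tendsto_toWeakSpace [CompleteSpace H] {ι : Type*} {l : Filter ι} [l.NeBot]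
    {x : ι → H} {S : Set H} {R : ℝ} (hR : ∀ᶠ i in l, ‖x i‖ ≤ R)
    (hnorm : ∀ z ∈ S, ∃ c, Tendsto (fun i => ‖x i - z‖ ^ 2) l (𝓝 c))
    (hclus : ∀ (U : Ultrafilter ι) (z : H), (U : Filter ι) ≤ l →
      (∀ w : H, Tendsto (fun i => inner ℝ w (x i)) U (𝓝 (inner ℝ w z))) → z ∈ S) :
    ∃ z ∈ S, Tendsto (fun i => toWeakSpace ℝ H (x i)) l (𝓝 (toWeakSpace ℝ H z)) := by
  set f : ι → WeakSpace ℝ H := fun i => toWeakSpace ℝ H (x i) with hf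
  have hK := isCompact_toWeakSpace_image_closedBall (H := H) R
  have hmem : ∀ᶠ i in l, f i ∈ toWeakSpace ℝ H '' Metric.closedBall 0 R := by
    filter_upwards [hR] with i hi
    exact mem_image_of_mem _ (by simpa using hi)
  have hcl : ∀ z : H, MapClusterPt (toWeakSpace ℝ H z) l f → ∃ U : Ultrafilter ι,
      (U : Filter ι) ≤ l ∧ z ∈ S ∧
        ∀ w : H, Tendsto (fun i => inner ℝ w (x i)) U (𝓝 (inner ℝ w z)) := by
    intro z hz
    obtain ⟨U, hU, hUt⟩ := mapClusterPt_iff_ultrafilter.1 hz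
    have := tendsto_toWeakSpace_iff_inner.1 hUt
    exact ⟨U, hU, hclus U z hU this, this⟩
  have huniq : ∀ z₁ z₂ : H, MapClusterPt (toWeakSpace ℝ H z₁) l f →
      MapClusterPt (toWeakSpace ℝ H z₂) l f → z₁ = z₂ := by
    intro z₁ z₂ h₁ h₂
    obtain ⟨U₁, hU₁, hz₁, ht₁⟩ := hcl z₁ h₁
    obtain ⟨U₂, hU₂, hz₂, ht₂⟩ := hcl z₂ h₂
    obtain ⟨c₁, hc₁⟩ := hnorm z₁ hz₁
    obtain ⟨c₂, hc₂⟩ := hnorm z₂ hz₂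
    -- ‖x − z₁‖² − ‖x − z₂‖² is affine in ⟨z₁ − z₂, x⟩, which therefore converges along all of l and
    -- takes the same value at both cluster points.
    have hlim : Tendsto (fun i => inner ℝ (z₁ - z₂) (x i)) l
        (𝓝 (((‖z₁‖ ^ 2 - ‖z₂‖ ^ 2) - (c₁ - c₂)) / 2)) := by
      refine (((hc₁.sub hc₂).const_sub (‖z₁‖ ^ 2 - ‖z₂‖ ^ 2)).div_const 2).congr fun i => ?_
      rw [norm_sub_sq_real, norm_sub_sq_real, inner_sub_left, real_inner_comm z₁,
        real_inner_comm z₂]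
      ring
    have e₁ := tendsto_nhds_unique (ht₁ (z₁ - z₂)) (hlim.mono_left hU₁)
    have e₂ := tendsto_nhds_unique (ht₂ (z₁ - z₂)) (hlim.mono_left hU₂)
    have : inner ℝ (z₁ - z₂) (z₁ - z₂) = 0 := by
      rw [inner_sub_right, e₁, e₂, sub_self]
    exact sub_eq_zero.1 (inner_self_eq_zero.1 this)
  obtain ⟨y, hy, hyc⟩ := hK.exists_mapClusterPt_of_frequently hmem.frequently
  obtain ⟨z, -, rfl⟩ := hy
  obtain ⟨U, -, hzS, -⟩ := hcl z hyc
  refine ⟨z, hzS, hK.tendsto_nhds_of_unique_mapClusterPt hmem ?_⟩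
  rintro _ ⟨z', -, rfl⟩ hz'
  rw [huniq z' z hz' hyc]

end WeakConvergence

/-! ### The Lyapunov energy and its dissipation. -/

section Energy

variable {H : Type*} [NormedAddCommGroup H] [InnerProductSpace ℝ H]

/-- The Lyapunov energy along a curve `x` with velocity `v`; here `s` is the time scale and `r` its
derivative. -/
noncomputable def lyapunovEnergy (g : H → ℝ) (z : H) (α β γ b : ℝ) (s r e : ℝ → ℝ) (x v : ℝ → H)
    (t : ℝ) : ℝ :=
  s t ^ 2 * (g (x t + (γ + β / s t) • v t) - g z) + b * (s t * inner ℝ (x t - z) (v t))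
    + s t ^ 2 * ‖v t‖ ^ 2 / 2 + b / 2 * ((α - r t) * ‖x t - z‖ ^ 2)
    + s t ^ 2 * e t * ‖x t‖ ^ 2 / 2

/-- The weight α − r is chosen so that the ⟨x − z, v⟩ terms cancel once the equation eliminates x'';
the s²e⟨x, v⟩ terms cancel likewise. -/
theorem hasDerivAt_lyapunovEnergy [CompleteSpace H] {g : H → ℝ} (hg : Differentiable ℝ g) (z : H)
    (α β γ b : ℝ) {s r e : ℝ → ℝ} {x v : ℝ → H} {t p e' : ℝ} {a : H} (hst : s t ≠ 0)
    (hs : HasDerivAt s (r t) t) (hr : HasDerivAt r (-p) t) (he : HasDerivAt e e' t)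
    (hx : HasDerivAt x (v t) t) (hv : HasDerivAt v a t)
    (hode : a + (α / s t) • v t + gradient g (x t + (γ + β / s t) • v t) + e t • x t = 0) :
    HasDerivAt (lyapunovEnergy g z α β γ b s r e x v)
      (2 * s t * r t * (g (x t + (γ + β / s t) • v t) - g z)
        - b * s t * inner ℝ (x t + (γ + β / s t) • v t - z)
            (gradient g (x t + (γ + β / s t) • v t))
        - (β * r t + (α - b) * s t * (γ + β / s t))
            * inner ℝ (gradient g (x t + (γ + β / s t) • v t)) (v t)
        - s t ^ 2 * (γ + β / s t) * ‖gradient g (x t + (γ + β / s t) • v t)‖ ^ 2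
        - s t ^ 2 * (γ + β / s t) * e t * inner ℝ (gradient g (x t + (γ + β / s t) • v t)) (x t)
        + s t * (r t - (α - b)) * ‖v t‖ ^ 2 + b * p / 2 * ‖x t - z‖ ^ 2
        - b * s t * e t * inner ℝ (x t - z) (x t)
        + (s t * r t * e t + s t ^ 2 * e' / 2) * ‖x t‖ ^ 2) t := by
  have hθ : HasDerivAt (fun t => γ + β / s t) (-(β * r t) / s t ^ 2) t := by
    simpa using ((hasDerivAt_const t β).div hs hst).const_add γ
  have hy := hx.add (hθ.smul hv)
  set y : H := x t + (γ + β / s t) • v t with hydef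
  have hgy := (hg y).hasGradientAt.hasFDerivAt.comp_hasDerivAt t hy
  set n : H := gradient g y with hn
  have ha : a = -((α / s t) • v t) - n - e t • x t := by
    rw [← sub_eq_zero, ← hode]
    abel
  have hX : HasDerivAt (fun t => x t - z) (v t) t := hx.sub_const z
  have h1 := (hs.pow 2).mul (hgy.sub_const (g z))
  have h2 := ((hs.mul (hX.inner ℝ hv))).const_mul b
  have h3 := ((hs.pow 2).mul hv.norm_sq).div_const 2
  have h4 := (((hr.const_sub α)).mul hX.norm_sq).const_mul (b / 2)
  have h5 := (((hs.pow 2).mul he).mul hx.norm_sq).div_const 2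
  refine ((((h1.add h2).add h3).add h4).add h5).congr_deriv ?_
  simp only [InnerProductSpace.toDual_apply_apply, Pi.pow_apply, Pi.mul_apply, Function.comp_apply,
    Pi.add_apply, Pi.smul_apply', ← hydef]
  have hyz : y - z = (x t - z) + (γ + β / s t) • v t := by
    rw [hydef]
    abel
  rw [hyz, ha]
  simp only [inner_add_right, inner_sub_right, inner_add_left, inner_neg_right, inner_smul_right,
    inner_smul_left, real_inner_self_eq_norm_sq, RCLike.conj_to_real, real_inner_comm n (v t),
    real_inner_comm n (x t - z), real_inner_comm (v t) (x t)]
  field_simp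
  ring

/-- Completing the square in b(x − z) + sv writes the energy as a sum of nonnegative terms. -/
theorem le_lyapunovEnergy (g : H → ℝ) {z : H} (hz : z ∈ argmin g) (α β γ : ℝ) {b : ℝ}
    (hb : 0 < b) (s r e : ℝ → ℝ) (x v : ℝ → H) {t : ℝ} (he : 0 ≤ e t)
    (hr : r t ≤ (α - b) / 2) (hbα : b < α) :
    s t ^ 2 * (g (x t + (γ + β / s t) • v t) - g z) ≤ lyapunovEnergy g z α β γ b s r e x v t ∧
    ‖b • (x t - z) + s t • v t‖ ^ 2 / 2 ≤ lyapunovEnergy g z α β γ b s r e x v t ∧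
    b * (α - b) / 4 * ‖x t - z‖ ^ 2 ≤ lyapunovEnergy g z α β γ b s r e x v t := by
  have hG : 0 ≤ s t ^ 2 * (g (x t + (γ + β / s t) • v t) - g z) :=
    mul_nonneg (sq_nonneg _) (sub_nonneg.2 (hz _))
  have hxx : 0 ≤ s t ^ 2 * e t * ‖x t‖ ^ 2 / 2 := by positivity
  have hsq : ‖b • (x t - z) + s t • v t‖ ^ 2 = b ^ 2 * ‖x t - z‖ ^ 2
      + 2 * b * s t * inner ℝ (x t - z) (v t) + s t ^ 2 * ‖v t‖ ^ 2 := by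
    rw [norm_add_sq_real, norm_smul, norm_smul, mul_pow, mul_pow, inner_smul_left,
      inner_smul_right, Real.norm_eq_abs, Real.norm_eq_abs, sq_abs, sq_abs]
    simp only [RCLike.conj_to_real]
    ring
  have hsq0 : 0 ≤ ‖b • (x t - z) + s t • v t‖ ^ 2 := sq_nonneg _
  have hX : b * (α - b) / 4 * ‖x t - z‖ ^ 2 ≤ b / 2 * ((α - r t - b) * ‖x t - z‖ ^ 2) := by
    have : 0 ≤ b / 2 * (((α - b) / 2 - r t) * ‖x t - z‖ ^ 2) :=
      mul_nonneg (by linarith) (mul_nonneg (by linarith) (sq_nonneg _))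
    linarith
  have hX0 : 0 ≤ b * (α - b) / 4 * ‖x t - z‖ ^ 2 :=
    mul_nonneg (div_nonneg (mul_nonneg hb.le (by linarith)) (by norm_num)) (sq_nonneg _)
  have hE : lyapunovEnergy g z α β γ b s r e x v t
      = s t ^ 2 * (g (x t + (γ + β / s t) • v t) - g z) + ‖b • (x t - z) + s t • v t‖ ^ 2 / 2
        + b / 2 * ((α - r t - b) * ‖x t - z‖ ^ 2) + s t ^ 2 * e t * ‖x t‖ ^ 2 / 2 := by
    rw [hsq, lyapunovEnergy]
    ring
  refine ⟨?_, ?_, ?_⟩ <;> linarith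

/-- Half of s²θ‖n‖² absorbs ⟨n, v⟩ and half absorbs ⟨n, x⟩, by Young. The Tikhonov term −bse⟨x − z,
x⟩, expanded by polarization, pays for p‖x − z‖² and r‖x‖², leaving only ‖z‖². -/
theorem deriv_lyapunovEnergy_le {x v z n : H} {G s r p e e' θ β α b K Θ : ℝ}
    (hb : 0 < b) (hs : 0 < s) (he : 0 ≤ e) (he' : e' ≤ 0) (hG : 0 ≤ G)
    (hGn : G ≤ inner ℝ (x + θ • v - z) n) (hrb : r ≤ b / 2) (hrα : r ≤ (α - b) / 2)
    (hβ : |β * r| ≤ s * θ) (hθ : θ ≤ Θ) (hθs : (1 + α) ^ 2 * θ ≤ (α - b) * s)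
    (hp : p ≤ s * e) (hK : s * e ≤ K) (hbα : b < α) :
    2 * s * r * G - b * s * inner ℝ (x + θ • v - z) n
        - (β * r + (α - b) * s * θ) * inner ℝ n v - s ^ 2 * θ * ‖n‖ ^ 2
        - s ^ 2 * θ * e * inner ℝ n x + s * (r - (α - b)) * ‖v‖ ^ 2 + b * p / 2 * ‖x - z‖ ^ 2
        - b * s * e * inner ℝ (x - z) x + (s * r * e + s ^ 2 * e' / 2) * ‖x‖ ^ 2
      ≤ s * e * (b / 2 * ‖z‖ ^ 2 + K * Θ / 2 * ‖x‖ ^ 2) := by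
  have hsθ : 0 ≤ s * θ := (abs_nonneg _).trans hβ
  have hθ0 : 0 ≤ θ := nonneg_of_mul_nonneg_right hsθ hs
  have hse : 0 ≤ s * e := mul_nonneg hs.le he
  have h1 : 2 * s * r * G - b * s * inner ℝ (x + θ • v - z) n ≤ 0 := by
    have h := mul_le_mul_of_nonneg_left hGn (mul_nonneg hb.le hs.le)
    have h' : 0 ≤ 2 * s * G * (b / 2 - r) := mul_nonneg (by positivity) (by linarith)
    linarith
  have h2 : -((β * r + (α - b) * s * θ) * inner ℝ n v)
      ≤ s ^ 2 * θ * ‖n‖ ^ 2 / 2 + (1 + α) ^ 2 * θ * ‖v‖ ^ 2 / 2 := by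
    have hc : |β * r + (α - b) * s * θ| ≤ (1 + α) * (s * θ) := by
      refine (abs_add_le _ _).trans ?_
      have : |(α - b) * s * θ| = (α - b) * (s * θ) := by
        rw [mul_assoc, abs_of_nonneg (mul_nonneg (by linarith) hsθ)]
      rw [this]
      have := mul_nonneg hb.le hsθ
      linarith
    have habs : |(β * r + (α - b) * s * θ) * inner ℝ n v|
        ≤ (1 + α) * (s * θ) * (‖n‖ * ‖v‖) := by
      rw [abs_mul]
      exact mul_le_mul hc (abs_real_inner_le_norm n v) (abs_nonneg _) ((abs_nonneg _).trans hc)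
    have hsq : 0 ≤ θ / 2 * (s * ‖n‖ - (1 + α) * ‖v‖) ^ 2 := by positivity
    have := neg_le_abs ((β * r + (α - b) * s * θ) * inner ℝ n v)
    linarith
  have h3 : -(s ^ 2 * θ * e * inner ℝ n x)
      ≤ s ^ 2 * θ * ‖n‖ ^ 2 / 2 + s * e * (K * Θ / 2 * ‖x‖ ^ 2) := by
    have hsq : 0 ≤ s ^ 2 * θ / 2 * ‖n + e • x‖ ^ 2 := by positivity
    rw [norm_add_sq_real, inner_smul_right, norm_smul, Real.norm_of_nonneg he] at hsq
    have hKΘ : s * e * θ ≤ K * Θ := mul_le_mul hK hθ hθ0 (hse.trans hK)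
    have := mul_le_mul_of_nonneg_left hKΘ (mul_nonneg hse (sq_nonneg ‖x‖))
    linarith
  have h4 : s * (r - (α - b)) * ‖v‖ ^ 2 + (1 + α) ^ 2 * θ * ‖v‖ ^ 2 / 2 ≤ 0 := by
    have h := mul_le_mul_of_nonneg_right hθs (sq_nonneg ‖v‖)
    have h' : 0 ≤ s * ((α - b) / 2 - r) * ‖v‖ ^ 2 :=
      mul_nonneg (mul_nonneg hs.le (by linarith)) (sq_nonneg _)
    linarith
  have h5 : b * p / 2 * ‖x - z‖ ^ 2 ≤ b * (s * e) / 2 * ‖x - z‖ ^ 2 := by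
    gcongr
  have h6 : b * s * e * inner ℝ (x - z) x
      = b * (s * e) / 2 * (‖x - z‖ ^ 2 + ‖x‖ ^ 2 - ‖z‖ ^ 2) := by
    rw [norm_sub_sq_real, inner_sub_left, real_inner_self_eq_norm_sq, real_inner_comm]
    ring
  have h7 : (s * r * e + s ^ 2 * e' / 2) * ‖x‖ ^ 2 ≤ b * (s * e) / 2 * ‖x‖ ^ 2 := by
    refine mul_le_mul_of_nonneg_right ?_ (sq_nonneg _)
    have h := mul_nonneg hse (sub_nonneg.2 hrb)
    have h' := mul_nonneg (sq_nonneg s) (neg_nonneg.2 he')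
    linarith
  linarith

end Energy

/-! ### Convergence of the energy along a solution. -/

section Trajectory

variable {H : Type*} [NormedAddCommGroup H] [InnerProductSpace ℝ H]

theorem tendsto_const_mul_rpow_sub_one {q : ℝ} (hq : q < 1) :
    Tendsto (fun t : ℝ => q * t ^ (q - 1)) atTop (𝓝 0) := by
  have h := (tendsto_rpow_neg_atTop (y := 1 - q) (by linarith)).const_mul q
  simpa using h

theorem exists_tendsto_lyapunovEnergy [CompleteSpace H]
    {g : H → ℝ} (hg_conv : ConvexOn ℝ univ g) (hg_diff : Differentiable ℝ g)
    {α β γ q t₀ b : ℝ} (ht₀ : 0 < t₀) (hq : q ∈ Ioo (0 : ℝ) 1)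
    (hγβ : 0 < γ ∨ (γ = 0 ∧ 0 < β)) (hb : 0 < b) (hbα : b < α)
    {ε : ℝ → ℝ} (hε_nonneg : ∀ t ∈ Ici t₀, 0 ≤ ε t) (hε_anti : AntitoneOn ε (Ici t₀))
    (hε_C1 : ContDiffOn ℝ 1 ε (Ici t₀)) {K : ℝ}
    (hε_bounds : ∀ᶠ t : ℝ in atTop, q * (1 - q) / t ^ 2 ≤ ε t ∧ ε t ≤ K / t ^ q)
    (hε_int : MeasureTheory.IntegrableOn (fun t : ℝ => t ^ q * ε t) (Ici t₀))
    {u₀ v₀ : H} {x : ℝ → H} (hx : IsGlobalSolution g ε α β γ q t₀ u₀ v₀ x)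
    {z : H} (hz : z ∈ argmin g) :
    ∃ l, Tendsto (lyapunovEnergy g z α β γ b (fun t => t ^ q) (fun t => q * t ^ (q - 1)) ε x
      (deriv x)) atTop (𝓝 l) := by
  obtain ⟨hq0, hq1⟩ := hq
  have hγ : 0 ≤ γ := by rcases hγβ with h | h <;> linarith
  have hs : Tendsto (fun t : ℝ => t ^ q) atTop atTop := tendsto_rpow_atTop hq0
  have hr : Tendsto (fun t : ℝ => q * t ^ (q - 1)) atTop (𝓝 0) :=
    tendsto_const_mul_rpow_sub_one hq1
  have hθ : Tendsto (fun t : ℝ => γ + β / t ^ q) atTop (𝓝 γ) := by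
    simpa using (hs.const_div_atTop β).const_add γ
  -- The right side is γt^q + β, which tends to infinity or equals β > 0, while the left side tends
  -- to 0.
  have hβr : ∀ᶠ t : ℝ in atTop, |β * (q * t ^ (q - 1))| ≤ t ^ q * (γ + β / t ^ q) := by
    have hβr0 : Tendsto (fun t : ℝ => |β * (q * t ^ (q - 1))|) atTop (𝓝 0) := by
      simpa using (hr.const_mul β).abs
    have hexp : ∀ t : ℝ, 0 < t → t ^ q * (γ + β / t ^ q) = γ * t ^ q + β := fun t ht => by
      have := (Real.rpow_pos_of_pos ht q).ne'
      field_simp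
    rcases hγβ with h | ⟨h, hβ⟩
    · filter_upwards [eventually_gt_atTop 0, hβr0.eventually (gt_mem_nhds one_pos),
        (hs.const_mul_atTop h).eventually_ge_atTop (1 - β)] with t h0 h1 h2
      rw [hexp t h0]
      linarith
    · filter_upwards [eventually_gt_atTop 0, hβr0.eventually (gt_mem_nhds hβ)] with t h0 h1
      rw [hexp t h0, h]
      linarith
  set A : ℝ := b * (α - b) / 4 with hA
  have hApos : 0 < A := by
    have := mul_pos hb (sub_pos.2 hbα)
    positivity
  obtain ⟨T, hT⟩ := eventually_atTop.1
    (((eventually_gt_atTop t₀).and (hε_bounds.and hβr)).and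
      ((hr.eventually (gt_mem_nhds (half_pos hb))).and
        ((hr.eventually (gt_mem_nhds (half_pos (sub_pos.2 hbα)))).and
          ((hθ.eventually (gt_mem_nhds (lt_add_one γ))).and
            (hs.eventually_ge_atTop ((1 + α) ^ 2 * (γ + 1) / (α - b)))))))
  set E := lyapunovEnergy g z α β γ b (fun t => t ^ q) (fun t => q * t ^ (q - 1)) ε x (deriv x)
    with hE
  have hTt₀ : t₀ < T := (hT T le_rfl).1.1
  have hKnonneg : 0 ≤ K := by
    have h := (hT T le_rfl).1.2.1.2
    have h0 := Real.rpow_pos_of_pos (ht₀.trans hTt₀) q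
    rw [le_div_iff₀ h0] at h
    exact (mul_nonneg (hε_nonneg T hTt₀.le) h0.le).trans h
  -- From ‖x‖² ≤ 2‖x − z‖² + 2‖z‖², A‖x − z‖² ≤ E, and γ + 1 as an eventual bound for θ.
  set C : ℝ := b / 2 * ‖z‖ ^ 2 + K * (γ + 1) * ‖z‖ ^ 2 + K * (γ + 1) / A with hC
  have hbound : ∀ t, T ≤ t → 0 ≤ E t ∧ A * ‖x t - z‖ ^ 2 ≤ E t := by
    intro t ht
    obtain ⟨⟨h0, -⟩, -, h2, -⟩ := hT t ht
    have := le_lyapunovEnergy g hz α β γ hb (fun t => t ^ q) (fun t => q * t ^ (q - 1)) ε x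
      (deriv x) (t := t) (hε_nonneg t h0.le) h2.le hbα
    exact ⟨le_trans (by positivity) this.2.1, this.2.2⟩
  have hderiv : ∀ t, T ≤ t → ∃ D, HasDerivAt E D t ∧ D ≤ (t ^ q * ε t * C) * (1 + E t) := by
    intro t ht
    obtain ⟨⟨h0, ⟨hlo, hhi⟩, hβ⟩, h1, h2, h3, h4⟩ := hT t ht
    have htpos : 0 < t := ht₀.trans h0
    have hspos : 0 < t ^ q := Real.rpow_pos_of_pos htpos q
    have hds : HasDerivAt (fun t : ℝ => t ^ q) (q * t ^ (q - 1)) t :=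
      Real.hasDerivAt_rpow_const (Or.inl htpos.ne')
    have hdr : HasDerivAt (fun t : ℝ => q * t ^ (q - 1)) (-(q * (1 - q) * t ^ (q - 2))) t := by
      refine ((Real.hasDerivAt_rpow_const (p := q - 1) (Or.inl htpos.ne')).const_mul q).congr_deriv
        ?_
      rw [show q - 1 - 1 = q - 2 by ring]
      ring
    have hdε : HasDerivAt ε (deriv ε t) t :=
      ((hε_C1.contDiffAt (Ici_mem_nhds h0)).differentiableAt one_ne_zero).hasDerivAt
    have hdε0 : deriv ε t ≤ 0 := by
      have := hε_anti.derivWithin_nonpos (x := t)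
      rwa [derivWithin_of_mem_nhds (Ici_mem_nhds h0)] at this
    have hx2 : ContDiffAt ℝ 2 x t := hx.contDiffOn_Ioi.contDiffAt (Ioi_mem_nhds h0)
    have hdx : HasDerivAt x (deriv x t) t := (hx2.differentiableAt two_ne_zero).hasDerivAt
    have hdv : HasDerivAt (deriv x) (deriv (deriv x) t) t :=
      ((hx2.derivWithin (m := 1) (by norm_num)).differentiableAt one_ne_zero).hasDerivAt
    have hp : q * (1 - q) * t ^ (q - 2) ≤ t ^ q * ε t := by
      refine le_trans (le_of_eq ?_) (mul_le_mul_of_nonneg_left hlo hspos.le)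
      rw [Real.rpow_sub htpos, Real.rpow_two]
      ring
    have hK : t ^ q * ε t ≤ K := by
      rw [le_div_iff₀ hspos] at hhi
      linarith
    have hθs : (1 + α) ^ 2 * (γ + β / t ^ q) ≤ (α - b) * t ^ q := by
      rw [div_le_iff₀ (sub_pos.2 hbα)] at h4
      have := mul_le_mul_of_nonneg_left h3.le (sq_nonneg (1 + α))
      linarith
    have hGn : g (x t + (γ + β / t ^ q) • deriv x t) - g z ≤
        inner ℝ (x t + (γ + β / t ^ q) • deriv x t - z)
          (gradient g (x t + (γ + β / t ^ q) • deriv x t)) := by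
      have := hg_conv.add_inner_gradient_le (hg_diff (x t + (γ + β / t ^ q) • deriv x t)) z
      rw [← neg_sub, inner_neg_right, real_inner_comm] at this
      linarith
    refine ⟨_, hasDerivAt_lyapunovEnergy hg_diff z α β γ b hspos.ne' hds hdr hdε hdx hdv
      (hx.equation t h0), ?_⟩
    refine (deriv_lyapunovEnergy_le hb hspos (hε_nonneg t h0.le) hdε0 (sub_nonneg.2 (hz _)) hGn
      h1.le h2.le hβ h3.le hθs hp hK hbα).trans ?_
    rw [mul_assoc (t ^ q * ε t)]
    refine mul_le_mul_of_nonneg_left ?_ (mul_nonneg hspos.le (hε_nonneg t h0.le))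
    obtain ⟨hE0, hEA⟩ := hbound t ht
    have hnorm : ‖x t‖ ^ 2 ≤ 2 * ‖x t - z‖ ^ 2 + 2 * ‖z‖ ^ 2 := by
      have h := norm_le_norm_sub_add (x t) z
      have h' := pow_le_pow_left₀ (norm_nonneg _) h 2
      have := sq_nonneg (‖x t - z‖ - ‖z‖)
      linarith
    have hXE : ‖x t - z‖ ^ 2 ≤ E t / A := by
      rw [le_div_iff₀ hApos]
      linarith
    have hKγ : 0 ≤ K * (γ + 1) := mul_nonneg hKnonneg (by linarith)
    have hCz : 0 ≤ b / 2 * ‖z‖ ^ 2 + K * (γ + 1) * ‖z‖ ^ 2 := by positivity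
    have hCA : 0 ≤ K * (γ + 1) / A := by positivity
    calc b / 2 * ‖z‖ ^ 2 + K * (γ + 1) / 2 * ‖x t‖ ^ 2
        ≤ b / 2 * ‖z‖ ^ 2 + K * (γ + 1) / 2 * (2 * (E t / A) + 2 * ‖z‖ ^ 2) := by
          gcongr
          linarith
      _ = b / 2 * ‖z‖ ^ 2 + K * (γ + 1) * ‖z‖ ^ 2 + K * (γ + 1) / A * E t := by ring
      _ ≤ C * (1 + E t) := by
          have := mul_nonneg hCz hE0
          rw [hC]
          linarith
  choose! D hD using hderiv
  have hIoi : Ioi T ⊆ Ici t₀ := fun t ht => (hTt₀.trans ht).le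
  refine tendsto_of_deriv_le_mul_one_add (fun t ht => (hD t ht).1) (fun t ht => (hbound t ht).1)
    ?_ ((hε_int.mono_set hIoi).mul_const C) (fun t ht => (hD t ht).2)
  refine (ContinuousOn.mul ?_ (hε_C1.continuousOn.mono (Ici_subset_Ici.2 hTt₀.le))).mul
    continuousOn_const
  exact continuousOn_id.rpow_const fun t _ => Or.inr hq0.le

end Trajectory

/-! ### Bounds on the trajectory and weak convergence. -/

theorem theorem3p3 {H : Type*} [NormedAddCommGroup H] [InnerProductSpace ℝ H] [CompleteSpace H]
    (g : H → ℝ) (hg_conv : ConvexOn ℝ univ g) (hg_diff : Differentiable ℝ g)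
    (hg_lip : LipschitzOnBounded (gradient g)) (hg_min : (argmin g).Nonempty)
    (α β γ q t₀ : ℝ) (ht₀ : 0 < t₀) (hα : 0 < α) (hq : q ∈ Ioo (0 : ℝ) 1)
    (hγβ : 0 < γ ∨ (γ = 0 ∧ 0 < β))
    (hβ_neg : β < 0 → |β / γ| ^ (1 / q) < t₀)
    (ε : ℝ → ℝ) (hε_nonneg : ∀ t ∈ Ici t₀, 0 ≤ ε t) (hε_anti : AntitoneOn ε (Ici t₀))
    (hε_C1 : ContDiffOn ℝ 1 ε (Ici t₀)) (hε_lim : Tendsto ε atTop (𝓝 0))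
    (hε_bounds : ∃ K : ℝ, 0 < K ∧
      ∀ᶠ t : ℝ in atTop, q * (1 - q) / t ^ 2 ≤ ε t ∧ ε t ≤ K / t ^ q)
    (hε_int : MeasureTheory.IntegrableOn (fun t : ℝ => t ^ q * ε t) (Ici t₀))
    (u₀ v₀ : H) (x : ℝ → H) (hx : IsGlobalSolution g ε α β γ q t₀ u₀ v₀ x) :
    ∃ z ∈ argmin g,
      Tendsto (fun t : ℝ => toWeakSpace ℝ H (x t)) atTop (𝓝 (toWeakSpace ℝ H z)) := by
  obtain ⟨K, -, hεK⟩ := hε_bounds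
  obtain ⟨z₀, hz₀⟩ := hg_min
  have hlim : ∀ b, 0 < b → b < α → ∀ z ∈ argmin g, ∃ l, Tendsto (lyapunovEnergy g z α β γ b
      (fun t => t ^ q) (fun t => q * t ^ (q - 1)) ε x (deriv x)) atTop (𝓝 l) :=
    fun b hb hbα z hz => exists_tendsto_lyapunovEnergy hg_conv hg_diff ht₀ hq hγβ hb hbα hε_nonneg
      hε_anti hε_C1 hεK hε_int hx hz
  have hs : Tendsto (fun t : ℝ => t ^ q) atTop atTop := tendsto_rpow_atTop hq.1
  have hr : Tendsto (fun t : ℝ => q * t ^ (q - 1)) atTop (𝓝 0) :=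
    tendsto_const_mul_rpow_sub_one hq.2
  have hθ : Tendsto (fun t : ℝ => γ + β / t ^ q) atTop (𝓝 γ) := by
    simpa using (hs.const_div_atTop β).const_add γ
  obtain ⟨B, hB0, hB⟩ : ∃ B : ℝ, 0 ≤ B ∧ ∀ᶠ t : ℝ in atTop, ‖x t - z₀‖ ≤ B ∧
      ‖t ^ q • deriv x t‖ ≤ B ∧
      (t ^ q) ^ 2 * (g (x t + (γ + β / t ^ q) • deriv x t) - g z₀) ≤ B := by
    obtain ⟨l, hl⟩ := hlim (α / 2) (by linarith) (by linarith) z₀ hz₀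
    set M : ℝ := l + 1
    set R : ℝ := Real.sqrt (M / (α / 2 * (α - α / 2) / 4))
    set R' : ℝ := Real.sqrt (2 * M)
    -- M ≥ 0 is known only once a large t is given; |M| makes the bound nonnegative beforehand.
    refine ⟨max (R + M) (R' + α / 2 * R) ⊔ |M|, le_max_of_le_right (abs_nonneg _), ?_⟩
    filter_upwards [hl.eventually (gt_mem_nhds (lt_add_one l)), eventually_ge_atTop t₀,
      hr.eventually (gt_mem_nhds (show 0 < (α - α / 2) / 2 by linarith))] with t h1 h2 h3
    obtain ⟨e1, e2, e3⟩ := le_lyapunovEnergy g hz₀ α β γ (half_pos hα) (fun t => t ^ q)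
      (fun t => q * t ^ (q - 1)) ε x (deriv x) (t := t) (hε_nonneg t h2) h3.le (by linarith)
    have hM : 0 ≤ M := le_trans (by positivity) (e2.trans h1.le)
    have hX : ‖x t - z₀‖ ≤ R := by
      refine Real.le_sqrt_of_sq_le ?_
      rw [le_div_iff₀ (by nlinarith)]
      linarith
    have hw : ‖(α / 2) • (x t - z₀) + t ^ q • deriv x t‖ ≤ R' := by
      refine Real.le_sqrt_of_sq_le ?_
      linarith
    refine ⟨?_, ?_, ?_⟩
    · exact le_max_of_le_left (le_max_of_le_left (by linarith))
    · refine le_max_of_le_left (le_max_of_le_right ?_)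
      have h4 : t ^ q • deriv x t = ((α / 2) • (x t - z₀) + t ^ q • deriv x t)
          - (α / 2) • (x t - z₀) := by abel
      rw [h4]
      refine (norm_sub_le _ _).trans (add_le_add hw ?_)
      rw [norm_smul, Real.norm_of_nonneg (by linarith)]
      gcongr
    · exact le_max_of_le_right ((e1.trans h1.le).trans (le_abs_self M))
  have hv : Tendsto (deriv x) atTop (𝓝 0) := by
    refine squeeze_zero_norm' ?_ (hs.const_div_atTop B)
    filter_upwards [hB, eventually_gt_atTop 0] with t h1 h2
    have hspos := Real.rpow_pos_of_pos h2 q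
    rw [le_div_iff₀ hspos, mul_comm]
    simpa [norm_smul, abs_of_pos hspos] using h1.2.1
  have hθv : Tendsto (fun t : ℝ => (γ + β / t ^ q) • deriv x t) atTop (𝓝 0) := by
    simpa using hθ.smul hv
  have hgy : Tendsto (fun t : ℝ => g (x t + (γ + β / t ^ q) • deriv x t)) atTop (𝓝 (g z₀)) := by
    have hup : Tendsto (fun t : ℝ => g z₀ + B / (t ^ q) ^ 2) atTop (𝓝 (g z₀)) := by
      simpa using (((tendsto_pow_atTop two_ne_zero).comp hs).const_div_atTop B).const_add (g z₀)
    refine tendsto_of_tendsto_of_tendsto_of_le_of_le' tendsto_const_nhds hup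
      (Eventually.of_forall fun t => hz₀ _) ?_
    filter_upwards [hB, eventually_gt_atTop 0] with t h1 h2
    have hspos := Real.rpow_pos_of_pos h2 q
    rw [← sub_le_iff_le_add', le_div_iff₀ (by positivity), mul_comm]
    exact h1.2.2
  have hxB : ∀ᶠ t : ℝ in atTop, ‖x t‖ ≤ B + ‖z₀‖ := by
    filter_upwards [hB] with t ht
    exact (norm_le_norm_sub_add (x t) z₀).trans (by linarith [ht.1])
  refine exists_tendsto_toWeakSpace hxB ?_ ?_
  · intro z hz
    obtain ⟨l₁, hl₁⟩ := hlim (α / 2) (by linarith) (by linarith) z hz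
    obtain ⟨l₂, hl₂⟩ := hlim (α / 3) (by linarith) (by linarith) z hz
    have hrX : Tendsto (fun t : ℝ => q * t ^ (q - 1) * ‖x t - z‖ ^ 2) atTop (𝓝 0) := by
      refine hr.zero_mul_isBoundedUnder_le ?_
      refine isBoundedUnder_of_eventually_le (a := (B + ‖z₀‖ + ‖z‖) ^ 2) ?_
      filter_upwards [hxB] with t ht
      have h : ‖x t - z‖ ≤ B + ‖z₀‖ + ‖z‖ := (norm_sub_le _ _).trans (by linarith)
      simpa using pow_le_pow_left₀ (norm_nonneg _) h 2
    -- The energies for α/2 and α/3 differ by (α/12)(sh' + (α − r)h), hence the factor 12/α; the rh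
    -- part tends to 0.
    refine ⟨_, tendsto_of_tendsto_rpow_mul_deriv_add_mul (h := fun t => ‖x t - z‖ ^ 2)
      (h' := fun t => 2 * inner ℝ (x t - z) (deriv x t)) (l := 12 / α * (l₁ - l₂) + 0) hq.2 hα
      ?_ ?_⟩
    · filter_upwards [eventually_gt_atTop t₀] with t ht
      exact (((hx.contDiffOn_Ioi.contDiffAt (Ioi_mem_nhds ht)).differentiableAt
        two_ne_zero).hasDerivAt.sub_const z).norm_sq
    · refine (((hl₁.sub hl₂).const_mul (12 / α)).add hrX).congr fun t => ?_
      simp only [lyapunovEnergy]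
      field_simp
      ring
  · intro U z hU hUz w
    -- The tangent minorant of g at z is weakly continuous, so g(z) ≤ lim g(y) = min g.
    have hinner : Tendsto (fun t : ℝ => g z + inner ℝ (gradient g z)
        (x t + (γ + β / t ^ q) • deriv x t - z)) U (𝓝 (g z)) := by
      have h := (((hUz (gradient g z)).add ((tendsto_const_nhds (x := gradient g z)).inner
        (hθv.mono_left hU) (𝕜 := ℝ))).sub_const (inner ℝ (gradient g z) z)).const_add (g z)
      simp only [inner_zero_right, add_zero, sub_self] at h
      refine h.congr fun t => ?_
      rw [inner_sub_right, inner_add_right]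
    exact (le_of_tendsto_of_tendsto' hinner (hgy.mono_left hU) fun t =>
      hg_conv.add_inner_gradient_le (hg_diff z) _).trans (hz₀ w)
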